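/- **Theorem 1 (Security of Semi-Device Independent Quantum Money).** Let $n,k\ge 0$ be integers. *Scheme.* The $k$ branches of the Bank share uniformly random key bits $(y_0^i,y_1^i)_{i=1}^n$; the banknote consists of $n$ qubits, the $i$-th one emitted by an untrusted source with input $(y_0^i,y_1^i)$. To verify the banknote, branch $l$ asks fresh uniformly random bits $x_l=(x_l^i)_{i=1}^n$, independent of the key and of the questions of the other branches, receives answers $a_l=(a_l^i)_{i=1}^n$, and accepts iff $|\{i : a_l^i=y^i_{x_l^i}\}|\ge\theta$. *Qubit-by-qubit attack.* The adversaries control the source and the verification terminals of all branches. From the questions of all branches they choose a pair $s$ of different branches to aim at ("birthday attack"). Given the key, the questions and $s$, the runs $i=1,\dots,n$ are independent (not necessarily identical), and in run $i$ the answers have probability $$P^i\big((a_l^i)_l \,\big|\, y_0^i,y_1^i,(x_l^i)_l,s\big)=\sum_r q^i(r)\,\mathrm{tr}\Big(\rho^{i,r}_{y_0^iy_1^i}\,M^{i,r,s}_{(a_l^i)_l\,|\,(x_l^i)_l}\Big),$$ where $q^i$ is a probability distribution on a finite set (classical randomness shared by the devices of run $i$; there is no entanglement between source and adversaries), the $\rho^{i,r}_{y_0y_1}$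 are density matrices on $\mathbb C^2$ and, for all $i,r,s$ and all questions, $\big(M^{i,r,s}_{a|(x_l^i)_l}\big)_{a\in\{0,1\}^k}$ is a POVM on $\mathbb C^2$. *Claim.* Let $\eta\ge 0$, $$\beta_\eta=\frac{9+2\sqrt2+\sqrt3}{16}+\frac{17+2\sqrt2+\sqrt3}{8}\,\eta ,$$ and let the acceptance threshold satisfy $\theta>\beta_\eta n$. Then, for every such attack, the probability that the banknote is accepted at two different branches is at most $$10\,k^2\,e^{-2\eta^2\left(\frac12-\eta\right)n}.$$ -/

import Mathlib

open scoped BigOperators Matrix ComplexOrder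

noncomputable section

/-- A (possibly mixed) state of a qubit: a `2 × 2` density matrix. -/
structure QubitState where
  mat : Matrix (Fin 2) (Fin 2) ℂ
  posSemidef : mat.PosSemidef
  trace_eq_one : mat.trace = 1

/-- A generalized measurement (POVM) on a qubit with outcomes in the finite type `O`. -/
structure QubitPOVM (O : Type) [Fintype O] where
  elem : O → Matrix (Fin 2) (Fin 2) ℂ
  posSemidef : ∀ o, (elem o).PosSemidef
  sum_eq_one : ∑ o, elem o = 1

/-- Born rule: the probability of outcome `o` when `M` is measured on the state `ρ`. -/
def QubitPOVM.prob {O : Type} [Fintype O] (M : QubitPOVM O) (ρ : QubitState) (o : O) : ℝ :=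
  (Matrix.trace (ρ.mat * M.elem o)).re

/-- An unordered pair of two different branches, out of the branches `Fin k`. -/
abbrev BranchPair (k : ℕ) : Type := {s : Finset (Fin k) // s.card = 2}

/-- The untrusted devices that handle one qubit of the banknote, when the Bank has `k` branches.
The pair of key bits of the run is a function `Bool → Bool` (its value at `b` is the bit `y_b`),
and `false`, `true` stand for the bits `0`, `1`.

* The source and the terminals are not entangled; they may share a classical random variable with
  values in `Fin size` and law `weight`.
* `source r y` is the qubit that the source emits on input `y`.
* `measure r s x` is the joint measurement made on that qubit by the collaborating adversaries when
  the question of branch `l` in this run is `x l` and `s` is the pair of branches that they aim at;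
  the component `l` of its outcome is the answer given to branch `l`. The measurement
  does not see the key bits. -/
structure RunDevice (k : ℕ) where
  size : ℕ
  weight : Fin size → ℝ
  weight_nonneg : ∀ r, 0 ≤ weight r
  weight_sum : ∑ r, weight r = 1
  source : Fin size → (Bool → Bool) → QubitState
  measure : Fin size → BranchPair k → (Fin k → Bool) → QubitPOVM (Fin k → Bool)

/-- Conditional probability, in one run, of the answers `a` given the key bits `y`, the questions
`x` of all branches and the targeted pair `s`. -/
def RunDevice.prob {k : ℕ} (D : RunDevice k) (s : BranchPair k)
    (y : Bool → Bool) (x a : Fin k → Bool) : ℝ :=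
  ∑ r, D.weight r * (D.measure r s x).prob (D.source r y) a

/-- A qubit-by-qubit attack on a banknote of `n` qubits by adversaries who control the source and
the terminals at the `k` branches: independent, not necessarily identical, devices for the `n`
qubits, and a rule by which the adversaries choose, from all questions of all branches, the pair of
branches that they aim at ("birthday attack"). Here `x i l` is the question of branch `l` in
run `i`. -/
structure QubitwiseAttack (k n : ℕ) where
  device : Fin n → RunDevice k
  target : (Fin n → Fin k → Bool) → BranchPair k

/-- The joint probability of key `y`, questions `x` and answers `a`. The Bank's `2 n` key bits and
`k n` question bits are independent uniform bits; given these, the runs are independent. -/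
def QubitwiseAttack.jointProb {k n : ℕ} (A : QubitwiseAttack k n)
    (y : Fin n → Bool → Bool) (x a : Fin n → Fin k → Bool) : ℝ :=
  ∏ i, (1 / 4 : ℝ) * (1 / 2 : ℝ) ^ k * (A.device i).prob (A.target x) (y i) (x i) (a i)

/-- The number of runs in which the answer given to branch `l` is the key bit it asked for. -/
def correctAnswers {k n : ℕ} (y : Fin n → Bool → Bool) (x a : Fin n → Fin k → Bool)
    (l : Fin k) : ℕ :=
  (Finset.univ.filter fun i => a i l = y i (x i l)).card

/-- Branch `l` accepts: the number of correct answers reaches the acceptance threshold `θ`. -/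
def Accepts {k n : ℕ} (θ : ℝ) (y : Fin n → Bool → Bool) (x a : Fin n → Fin k → Bool)
    (l : Fin k) : Prop :=
  θ ≤ (correctAnswers y x a l : ℝ)

/-- Successful forgery: the banknote is accepted at two different branches. -/
def Forged {k n : ℕ} (θ : ℝ) (y : Fin n → Bool → Bool) (x a : Fin n → Fin k → Bool) : Prop :=
  ∃ l l' : Fin k, l ≠ l' ∧ Accepts θ y x a l ∧ Accepts θ y x a l'

open Classical in
/-- The probability of a successful forgery. -/
def QubitwiseAttack.forgeryProb {k n : ℕ} (A : QubitwiseAttack k n) (θ : ℝ) : ℝ :=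
  ∑ y : Fin n → Bool → Bool, ∑ x : Fin n → Fin k → Bool, ∑ a : Fin n → Fin k → Bool,
    if Forged θ y x a then A.jointProb y x a else 0

/-- The critical fraction `β_η` of correct answers. -/
def criticalFraction (η : ℝ) : ℝ :=
  (9 + 2 * Real.sqrt 2 + Real.sqrt 3) / 16 + (17 + 2 * Real.sqrt 2 + Real.sqrt 3) / 8 * η

end

/-! Fix the targeted pair `s` and two branches `l ≠ l'`. In one run, the mean fraction of correct
answers at `l`, `l'` is at most `0.81` (`RunDevice.expected_pairScore_le`). In Bloch form a POVM is
a family of vectors with sum zero, each no longer than the trace of its element. If both branches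
ask for the same bit, the gain over guessing is governed by the Walsh coefficient of the source for
that bit, and the two coefficients have norms summing to at most `√2`, as in a random access code.
If they ask for different bits, the mean is at most `3/4`. Averaging over questions gives at most
`(10 + 2√2)/16 < 0.81`.

For fixed `s` the runs are independent, so a Chernoff bound applies. The choice of `s` may depend on
all questions; a union bound over `s` and over the accepting pair costs `k ^ 4`. As the threshold
exceeds `0.81 n` with room to spare, this gives `(k ^ 2 * E) ^ 2` with `E = exp (-η ^ 2 * n)`. A
probability is also at most `1`, hence at most `k ^ 2 * E`. -/

/-! ### Qubit states and measurements in Bloch form -/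

/-- The (unnormalized) Bloch vector of a `2 × 2` matrix. -/
noncomputable def bloch : Matrix (Fin 2) (Fin 2) ℂ →+ EuclideanSpace ℝ (Fin 3) where
  toFun M := !₂[2 * (M 0 1).re, 2 * (M 0 1).im, (M 0 0).re - (M 1 1).re]
  map_zero' := by ext i; fin_cases i <;> simp
  map_add' M N := by ext i; fin_cases i <;> simp <;> ring

theorem bloch_one : bloch 1 = 0 := by
  ext i; fin_cases i <;> simp [bloch]

/-- For Hermitian `M`, `(tr M)² - ‖bloch M‖² = 4 det M`, and both determinant and trace are
nonnegative here. -/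
theorem Matrix.PosSemidef.norm_bloch_le {M : Matrix (Fin 2) (Fin 2) ℂ} (hM : M.PosSemidef) :
    ‖bloch M‖ ≤ M.trace.re := by
  have hdet := hM.det_nonneg
  have htr := hM.trace_nonneg
  have hH := hM.isHermitian
  have h10 : M 1 0 = star (M 0 1) := (hH.apply 1 0).symm
  have h0 : (M 0 0).im = 0 := by
    have h := congrArg Complex.im (hH.apply 0 0)
    simp at h; linarith
  have h1 : (M 1 1).im = 0 := by
    have h := congrArg Complex.im (hH.apply 1 1)
    simp at h; linarith
  rw [Matrix.det_fin_two, h10] at hdet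
  have hd := (Complex.le_def.1 hdet).1
  have ht := (Complex.le_def.1 htr).1
  simp [Matrix.trace_fin_two, h0, h1] at hd ht
  refine abs_le_of_sq_le_sq' ?_ (by simpa [Matrix.trace_fin_two] using ht) |>.2
  rw [EuclideanSpace.norm_sq_eq]
  simp [Fin.sum_univ_three, bloch, Matrix.trace_fin_two]
  nlinarith

theorem trace_mul_re_eq_bloch {M N : Matrix (Fin 2) (Fin 2) ℂ} (hM : M.IsHermitian)
    (hN : N.IsHermitian) :
    (M * N).trace.re = (M.trace.re * N.trace.re + inner ℝ (bloch M) (bloch N)) / 2 := by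
  have hM10 : M 1 0 = star (M 0 1) := (hM.apply 1 0).symm
  have hN10 : N 1 0 = star (N 0 1) := (hN.apply 1 0).symm
  have im0 : ∀ {A : Matrix (Fin 2) (Fin 2) ℂ}, A.IsHermitian → ∀ i, (A i i).im = 0 := by
    intro A hA i
    have h := congrArg Complex.im (hA.apply i i)
    simp at h; linarith
  simp [Matrix.trace_fin_two, Matrix.mul_apply, hM10, hN10, im0 hM, im0 hN, bloch,
    PiLp.inner_apply, Fin.sum_univ_three]
  ring

theorem QubitState.norm_bloch_le_one (ρ : QubitState) : ‖bloch ρ.mat‖ ≤ 1 := by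
  simpa [ρ.trace_eq_one] using ρ.posSemidef.norm_bloch_le

theorem QubitPOVM.prob_eq_bloch {O : Type} [Fintype O] (M : QubitPOVM O) (ρ : QubitState) (o : O) :
    M.prob ρ o = ((M.elem o).trace.re + inner ℝ (bloch ρ.mat) (bloch (M.elem o))) / 2 := by
  rw [QubitPOVM.prob, trace_mul_re_eq_bloch ρ.posSemidef.isHermitian (M.posSemidef o).isHermitian,
    ρ.trace_eq_one]
  simp

theorem QubitPOVM.prob_nonneg {O : Type} [Fintype O] (M : QubitPOVM O) (ρ : QubitState) (o : O) :
    0 ≤ M.prob ρ o := by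
  rw [M.prob_eq_bloch]
  have h1 := (M.posSemidef o).norm_bloch_le
  have h2 := ρ.norm_bloch_le_one
  have h3 := abs_le.1 (abs_real_inner_le_norm (bloch ρ.mat) (bloch (M.elem o)))
  nlinarith [norm_nonneg (bloch (M.elem o))]

theorem QubitPOVM.sum_trace {O : Type} [Fintype O] (M : QubitPOVM O) :
    ∑ o, (M.elem o).trace.re = 2 := by
  rw [← Complex.re_sum, ← Matrix.trace_sum, M.sum_eq_one]
  simp

theorem QubitPOVM.sum_bloch {O : Type} [Fintype O] (M : QubitPOVM O) :
    ∑ o, bloch (M.elem o) = 0 := by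
  rw [← map_sum, M.sum_eq_one, bloch_one]

theorem QubitPOVM.sum_prob {O : Type} [Fintype O] (M : QubitPOVM O) (ρ : QubitState) :
    ∑ o, M.prob ρ o = 1 := by
  simp_rw [M.prob_eq_bloch]
  rw [← Finset.sum_div, Finset.sum_add_distrib, M.sum_trace, ← inner_sum, M.sum_bloch]
  simp

theorem RunDevice.prob_nonneg {k : ℕ} (D : RunDevice k) (s : BranchPair k)
    (y : Bool → Bool) (x a : Fin k → Bool) : 0 ≤ D.prob s y x a :=
  Finset.sum_nonneg fun r _ => mul_nonneg (D.weight_nonneg r) (QubitPOVM.prob_nonneg _ _ _)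

theorem RunDevice.sum_prob {k : ℕ} (D : RunDevice k) (s : BranchPair k)
    (y : Bool → Bool) (x : Fin k → Bool) : ∑ a, D.prob s y x a = 1 := by
  simp_rw [RunDevice.prob]
  rw [Finset.sum_comm]
  simp_rw [← Finset.mul_sum, QubitPOVM.sum_prob, mul_one, D.weight_sum]

/-! ### Expected score of two branches in one run -/

/-- The fraction of correct answers that the branches `l`, `l'` receive in one run. -/
noncomputable def pairScore {k : ℕ} (l l' : Fin k) (y : Bool → Bool) (x a : Fin k → Bool) : ℝ :=
  ((if a l = y (x l) then 1 else 0) + (if a l' = y (x l') then 1 else 0)) / 2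

theorem pairScore_nonneg {k : ℕ} (l l' : Fin k) (y : Bool → Bool) (x a : Fin k → Bool) :
    0 ≤ pairScore l l' y x a := by
  unfold pairScore; positivity

theorem pairScore_le_one {k : ℕ} (l l' : Fin k) (y : Bool → Bool) (x a : Fin k → Bool) :
    pairScore l l' y x a ≤ 1 := by
  unfold pairScore; split_ifs <;> norm_num

theorem sum_bool_arrow (f : (Bool → Bool) → ℝ) :
    ∑ y, f y = f (fun b => cond b false false) + f (fun b => cond b true false)
      + f (fun b => cond b false true) + f (fun b => cond b true true) := by
  have e : ∀ p q : Bool, (Equiv.boolArrowEquivProd Bool).symm (p, q) = fun b => cond b q p := by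
    intro p q; funext b; cases b <;> rfl
  rw [← (Equiv.boolArrowEquivProd Bool).symm.sum_comp, Fintype.sum_prod_type]
  simp only [Fintype.sum_bool, e]
  ring

/-- A Walsh coefficient of a function of two bits, for the bit `b`. -/
noncomputable def bitBias {E : Type*} [AddCommGroup E] [Module ℝ E] (v : Bool → Bool → E)
    (b : Bool) : E :=
  (1 / 4 : ℝ) • (v false false - v true true
    + cond b (v true false - v false true) (v false true - v true false))

/-- Sum and difference of the two coefficients are half-differences of vectors in the unit ball. The
parallelogram law then bounds the sum of squares by `1`, so the sum of norms is at most `√2 < 1.42`.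
-/
theorem norm_bitBias_add_le {E : Type*} [NormedAddCommGroup E] [InnerProductSpace ℝ E]
    (v : Bool → Bool → E) (hv : ∀ p q, ‖v p q‖ ≤ 1) :
    ‖bitBias v false‖ + ‖bitBias v true‖ ≤ 1.42 := by
  have h := parallelogram_law_with_norm ℝ (bitBias v false) (bitBias v true)
  have h1 : bitBias v false + bitBias v true = (1 / 2 : ℝ) • (v false false - v true true) := by
    simp only [bitBias, cond]; module
  have h2 : bitBias v false - bitBias v true = (1 / 2 : ℝ) • (v false true - v true false) := by
    simp only [bitBias, cond]; module
  have n : ∀ p q p' q', ‖(1 / 2 : ℝ) • (v p q - v p' q')‖ ≤ 1 := by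
    intro p q p' q'
    rw [norm_smul]
    have := norm_sub_le (v p q) (v p' q')
    have := hv p q
    have := hv p' q'
    norm_num; linarith
  rw [h1, h2] at h
  have n1 := n false false true true
  have n2 := n false true true false
  nlinarith [norm_nonneg ((1 / 2 : ℝ) • (v false false - v true true)),
    norm_nonneg ((1 / 2 : ℝ) • (v false true - v true false)),
    sq_nonneg (‖bitBias v false‖ - ‖bitBias v true‖),
    norm_nonneg (bitBias v false), norm_nonneg (bitBias v true)]

/-- The expected number of correct answers exceeds that of random guessing, summed over the four
keys, by at most this amount when two branches ask for the bits `b` and `b'`. -/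
noncomputable def advantageBound {E : Type*} [NormedAddCommGroup E] [InnerProductSpace ℝ E]
    (v : Bool → Bool → E) (b b' : Bool) : ℝ :=
  if b = b' then 2 * ‖bitBias v b‖ else 1

/-- Contribution of one outcome, with trace `m₀` and Bloch vector `m`. The last term is linear in
`m`, so it vanishes when summed over the outcomes of a POVM. For equal questions, unequal answers
score `1/2` on every key; for different questions, only the guessed key and its complement deviate
from `1/2`. -/
theorem key_sum_le {k : ℕ} (l l' : Fin k) (x a : Fin k → Bool)
    {E : Type*} [NormedAddCommGroup E] [InnerProductSpace ℝ E]
    (v : Bool → Bool → E) (hv : ∀ p q, ‖v p q‖ ≤ 1) (m₀ : ℝ) (m : E) (hm : ‖m‖ ≤ m₀) :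
    ∑ y : Bool → Bool, (m₀ + inner ℝ (v (y false) (y true)) m) / 2 * pairScore l l' y x a
      ≤ m₀ * (1 + advantageBound v (x l) (x l') / 2)
        + inner ℝ (v false false + v false true + v true false + v true true) m / 4 := by
  have hm0 : 0 ≤ m₀ := (norm_nonneg m).trans hm
  have hi : ∀ p q, |inner ℝ (v p q) m| ≤ m₀ := fun p q =>
    (abs_real_inner_le_norm _ _).trans
      ((mul_le_mul (hv p q) hm (norm_nonneg _) zero_le_one).trans (one_mul m₀).le)
  have ht : ∀ b, |inner ℝ (bitBias v b) m| ≤ m₀ * ‖bitBias v b‖ := fun b =>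
    (abs_real_inner_le_norm _ _).trans
      (by rw [mul_comm]; exact mul_le_mul_of_nonneg_right hm (norm_nonneg _))
  have hn : ∀ b, 0 ≤ m₀ * ‖bitBias v b‖ := fun b => by positivity
  have a00 := abs_le.1 (hi false false)
  have a01 := abs_le.1 (hi false true)
  have a10 := abs_le.1 (hi true false)
  have a11 := abs_le.1 (hi true true)
  have t0 := abs_le.1 (ht false)
  have t1 := abs_le.1 (ht true)
  have n0 := hn false
  have n1 := hn true
  have e0 : inner ℝ (bitBias v false) m = (inner ℝ (v false false) m - inner ℝ (v true true) m
      + (inner ℝ (v false true) m - inner ℝ (v true false) m)) / 4 := by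
    simp only [bitBias, cond, inner_smul_left, inner_add_left, inner_sub_left]
    simp; ring
  have e1 : inner ℝ (bitBias v true) m = (inner ℝ (v false false) m - inner ℝ (v true true) m
      + (inner ℝ (v true false) m - inner ℝ (v false true) m)) / 4 := by
    simp only [bitBias, cond, inner_smul_left, inner_add_left, inner_sub_left]
    simp; ring
  rw [e0] at t0
  rw [e1] at t1
  rw [sum_bool_arrow]
  simp only [inner_add_left, pairScore, advantageBound, cond_false, cond_true]
  generalize inner ℝ (v false false) m = i00 at *
  generalize inner ℝ (v false true) m = i01 at *
  generalize inner ℝ (v true false) m = i10 at *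
  generalize inner ℝ (v true true) m = i11 at *
  generalize ha : a l = c
  generalize ha' : a l' = c'
  generalize hx : x l = b
  generalize hx' : x l' = b'
  cases b <;> cases b' <;> cases c <;> cases c' <;> simp <;> linarith

theorem QubitPOVM.sum_prob_mul_pairScore_le {k : ℕ} (l l' : Fin k) (x : Fin k → Bool)
    (M : QubitPOVM (Fin k → Bool)) (ρ : (Bool → Bool) → QubitState) :
    ∑ y, ∑ a, M.prob (ρ y) a * pairScore l l' y x a
      ≤ 2 + advantageBound (fun p q => bloch (ρ fun b => cond b q p).mat) (x l) (x l') := by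
  set v : Bool → Bool → EuclideanSpace ℝ (Fin 3) :=
    fun p q => bloch (ρ fun b => cond b q p).mat with hv
  have hy : ∀ y, bloch (ρ y).mat = v (y false) (y true) := by
    intro y
    have : (fun b => cond b (y true) (y false)) = y := by funext b; cases b <;> rfl
    simp only [hv, this]
  rw [Finset.sum_comm]
  refine (Finset.sum_le_sum fun a _ => ?_).trans (b := ∑ a, ((M.elem a).trace.re
    * (1 + advantageBound v (x l) (x l') / 2)
      + inner ℝ (v false false + v false true + v true false + v true true)
        (bloch (M.elem a)) / 4)) ?_
  · simp_rw [M.prob_eq_bloch, hy]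
    exact key_sum_le l l' x a v (fun p q => QubitState.norm_bloch_le_one _) _ _
      (M.posSemidef a).norm_bloch_le
  · rw [Finset.sum_add_distrib, ← Finset.sum_mul, M.sum_trace, ← Finset.sum_div, ← inner_sum,
      M.sum_bloch, inner_zero_right]
    apply le_of_eq; ring

/-- Flipping question bits permutes the summands; averaging over the four flips of the coordinates
`l`, `l'` makes the summand constant. -/
theorem sum_two_coords {ι : Type*} [Fintype ι] [DecidableEq ι] {l l' : ι} (hl : l ≠ l')
    (f : Bool → Bool → ℝ) :
    4 * ∑ x : ι → Bool, f (x l) (x l')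
      = 2 ^ Fintype.card ι * (f false false + f false true + f true false + f true true) := by
  have shift : ∀ b b' : Bool,
      ∑ x : ι → Bool, f (x l) (x l') = ∑ x : ι → Bool, f (xor (x l) b) (xor (x l') b') := by
    intro b b'
    let c : ι → Bool := fun j => if j = l then b else b'
    have hc : Function.Involutive fun (x : ι → Bool) j => xor (x j) (c j) := by
      intro x; funext j; simp
    refine (Equiv.sum_comp hc.toPerm fun x => f (x l) (x l')).symm.trans ?_
    simp [Function.Involutive.coe_toPerm, c, hl.symm]
  have key : 4 * ∑ x : ι → Bool, f (x l) (x l')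
      = ∑ x : ι → Bool, (f false false + f false true + f true false + f true true) := by
    calc 4 * ∑ x : ι → Bool, f (x l) (x l')
        = ∑ x : ι → Bool, f (xor (x l) false) (xor (x l') false)
          + ∑ x : ι → Bool, f (xor (x l) false) (xor (x l') true)
          + ∑ x : ι → Bool, f (xor (x l) true) (xor (x l') false)
          + ∑ x : ι → Bool, f (xor (x l) true) (xor (x l') true) := by
          rw [← shift, ← shift, ← shift, ← shift]; ring
      _ = _ := by
          rw [← Finset.sum_add_distrib, ← Finset.sum_add_distrib, ← Finset.sum_add_distrib]
          refine Finset.sum_congr rfl fun x _ => ?_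
          generalize x l = b
          generalize x l' = b'
          cases b <;> cases b' <;> simp <;> ring
  rw [key, Finset.sum_const, nsmul_eq_mul]
  simp

theorem sum_questions_le {k : ℕ} {l l' : Fin k} (hl : l ≠ l')
    (M : (Fin k → Bool) → QubitPOVM (Fin k → Bool)) (ρ : (Bool → Bool) → QubitState) :
    ∑ y, ∑ x, ∑ a, (M x).prob (ρ y) a * pairScore l l' y x a ≤ 2 ^ k * 3.24 := by
  set v : Bool → Bool → EuclideanSpace ℝ (Fin 3) :=
    fun p q => bloch (ρ fun b => cond b q p).mat with hv
  rw [Finset.sum_comm]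
  have h1 := Finset.sum_le_sum fun x (_ : x ∈ Finset.univ) =>
    (M x).sum_prob_mul_pairScore_le l l' x ρ
  have h2 := sum_two_coords hl fun b b' => 2 + advantageBound v b b'
  have h3 := norm_bitBias_add_le v fun p q => QubitState.norm_bloch_le_one _
  simp only [advantageBound, Fintype.card_fin] at h2
  simp at h2
  refine h1.trans ?_
  simp only [advantageBound, ← hv]
  have : (0 : ℝ) < 2 ^ k := by positivity
  -- The four question pairs contribute `10 + 2 * (‖bitBias v false‖ + ‖bitBias v true‖) ≤ 12.84`,
  -- below `4 * 3.24`.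
  nlinarith

/-! ### Law and exponential moment of one run -/

/-- Joint probability of key, questions and answers in one run aimed at the pair `s`. -/
noncomputable def RunDevice.jointProb {k : ℕ} (D : RunDevice k) (s : BranchPair k)
    (y : Bool → Bool) (x a : Fin k → Bool) : ℝ :=
  1 / 4 * (1 / 2) ^ k * D.prob s y x a

theorem RunDevice.jointProb_nonneg {k : ℕ} (D : RunDevice k) (s : BranchPair k)
    (y : Bool → Bool) (x a : Fin k → Bool) : 0 ≤ D.jointProb s y x a :=
  mul_nonneg (by positivity) (D.prob_nonneg s y x a)

theorem RunDevice.sum_jointProb_answers {k : ℕ} (D : RunDevice k) (s : BranchPair k)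
    (y : Bool → Bool) (x : Fin k → Bool) :
    ∑ a, D.jointProb s y x a = 1 / 4 * (1 / 2) ^ k := by
  simp_rw [RunDevice.jointProb, ← Finset.mul_sum, D.sum_prob, mul_one]

theorem RunDevice.sum_jointProb {k : ℕ} (D : RunDevice k) (s : BranchPair k) :
    ∑ y, ∑ x, ∑ a, D.jointProb s y x a = 1 := by
  simp_rw [D.sum_jointProb_answers]
  simp
  field_simp

theorem RunDevice.expected_pairScore_le {k : ℕ} (D : RunDevice k) (s : BranchPair k)
    {l l' : Fin k} (hl : l ≠ l') :
    ∑ y, ∑ x, ∑ a, D.jointProb s y x a * pairScore l l' y x a ≤ 0.81 := by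
  have e : ∑ y, ∑ x, ∑ a, D.jointProb s y x a * pairScore l l' y x a
      = ∑ r, D.weight r * (1 / 4 * (1 / 2) ^ k * ∑ y, ∑ x, ∑ a,
        (D.measure r s x).prob (D.source r y) a * pairScore l l' y x a) := by
    simp only [RunDevice.jointProb, RunDevice.prob, Finset.mul_sum, Finset.sum_mul]
    simp only [← Finset.sum_comm (s := (Finset.univ : Finset (Fin D.size)))]
    refine Finset.sum_congr rfl fun r _ => Finset.sum_congr rfl fun y _ =>
      Finset.sum_congr rfl fun x _ => Finset.sum_congr rfl fun a _ => by ring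
  rw [e]
  have hb : ∀ r, (1 / 4 * (1 / 2) ^ k * ∑ y, ∑ x, ∑ a,
        (D.measure r s x).prob (D.source r y) a * pairScore l l' y x a : ℝ) ≤ 0.81 := by
    intro r
    refine (mul_le_mul_of_nonneg_left (sum_questions_le hl _ _) (by positivity)).trans ?_
    apply le_of_eq
    have : ((1 / 2 : ℝ) ^ k) * 2 ^ k = 1 := by rw [← mul_pow]; norm_num
    linear_combination 0.81 * this
  calc _ ≤ ∑ r, D.weight r * 0.81 :=
        Finset.sum_le_sum fun r _ => mul_le_mul_of_nonneg_left (hb r) (D.weight_nonneg r)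
    _ = 0.81 := by rw [← Finset.sum_mul, D.weight_sum, one_mul]

theorem RunDevice.mgf_pairScore_le {k : ℕ} (D : RunDevice k) (s : BranchPair k)
    {l l' : Fin k} (hl : l ≠ l') {t : ℝ} (ht : 0 ≤ t) (ht1 : t ≤ 1) :
    ∑ y, ∑ x, ∑ a, D.jointProb s y x a * Real.exp (t * pairScore l l' y x a)
      ≤ Real.exp (0.81 * (t + t ^ 2)) := by
  have hexp : Real.exp t - 1 ≤ t + t ^ 2 := by
    have := Real.abs_exp_sub_one_sub_id_le (x := t) (by rwa [abs_of_nonneg ht])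
    linarith [(abs_le.1 this).2]
  -- Convexity: on `[0, 1]` the exponential lies below its chord, so only the mean score matters.
  have hchord : ∀ u : ℝ, 0 ≤ u → u ≤ 1 → Real.exp (t * u) ≤ 1 + (t + t ^ 2) * u := by
    intro u h0 h1
    have h := convexOn_exp.2 (Set.mem_univ (0 : ℝ)) (Set.mem_univ t) (sub_nonneg.2 h1) h0
      (by ring)
    simp only [smul_eq_mul, mul_zero, zero_add, Real.exp_zero, mul_one] at h
    rw [mul_comm t u]
    nlinarith
  calc _ ≤ ∑ y, ∑ x, ∑ a, (D.jointProb s y x a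
          + (t + t ^ 2) * (D.jointProb s y x a * pairScore l l' y x a)) := by
        refine Finset.sum_le_sum fun y _ => Finset.sum_le_sum fun x _ =>
          Finset.sum_le_sum fun a _ => ?_
        have := mul_le_mul_of_nonneg_left (hchord _ (pairScore_nonneg l l' y x a)
          (pairScore_le_one l l' y x a)) (D.jointProb_nonneg s y x a)
        linarith
    _ ≤ 0.81 * (t + t ^ 2) + 1 := by
        simp only [Finset.sum_add_distrib, ← Finset.mul_sum, D.sum_jointProb]
        have := mul_le_mul_of_nonneg_left (D.expected_pairScore_le s hl)
          (show 0 ≤ t + t ^ 2 by positivity)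
        linarith
    _ ≤ _ := Real.add_one_le_exp _

/-! ### Independent runs, Chernoff and union bounds -/

theorem sum_pi_prod {ι α β γ : Type*} [Fintype ι] [DecidableEq ι] [Fintype α] [Fintype β]
    [Fintype γ] (f : ι → α → β → γ → ℝ) :
    ∑ y : ι → α, ∑ x : ι → β, ∑ a : ι → γ, ∏ i, f i (y i) (x i) (a i)
      = ∏ i, ∑ y, ∑ x, ∑ a, f i y x a := by
  simp only [Fintype.prod_sum]

theorem QubitwiseAttack.jointProb_eq {k n : ℕ} (A : QubitwiseAttack k n)
    (y : Fin n → Bool → Bool) (x a : Fin n → Fin k → Bool) :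
    A.jointProb y x a = ∏ i, (A.device i).jointProb (A.target x) (y i) (x i) (a i) := rfl

theorem QubitwiseAttack.jointProb_nonneg {k n : ℕ} (A : QubitwiseAttack k n)
    (y : Fin n → Bool → Bool) (x a : Fin n → Fin k → Bool) : 0 ≤ A.jointProb y x a :=
  Finset.prod_nonneg fun i _ => (A.device i).jointProb_nonneg _ _ _ _

theorem QubitwiseAttack.forgeryProb_le_one {k n : ℕ} (A : QubitwiseAttack k n) (θ : ℝ) :
    A.forgeryProb θ ≤ 1 := by
  classical
  calc A.forgeryProb θ ≤ ∑ y, ∑ x, ∑ a, A.jointProb y x a := by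
        refine Finset.sum_le_sum fun y _ => Finset.sum_le_sum fun x _ =>
          Finset.sum_le_sum fun a _ => ?_
        split_ifs
        exacts [le_rfl, A.jointProb_nonneg y x a]
    _ = ∑ _y : Fin n → Bool → Bool, ∑ _x : Fin n → Fin k → Bool,
          (1 / 4 * (1 / 2) ^ k : ℝ) ^ n := by
        -- Answers are summed out with `x` fixed, since the target depends on `x` and the full sum
        -- does not factor over runs.
        refine Finset.sum_congr rfl fun y _ => Finset.sum_congr rfl fun x _ => ?_
        simp_rw [A.jointProb_eq, ← Fintype.prod_sum
          (fun i a => (A.device i).jointProb (A.target x) (y i) (x i) a),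
          RunDevice.sum_jointProb_answers]
        simp
    _ = 1 := by
        simp
        rw [← mul_pow, ← mul_pow]
        field_simp
        norm_num

theorem sum_pairScore {k n : ℕ} (l l' : Fin k) (y : Fin n → Bool → Bool)
    (x a : Fin n → Fin k → Bool) :
    ∑ i, pairScore l l' (y i) (x i) (a i)
      = ((correctAnswers y x a l : ℝ) + correctAnswers y x a l') / 2 := by
  simp only [pairScore, correctAnswers, ← Finset.sum_div, Finset.sum_add_distrib,
    Finset.card_filter, Nat.cast_sum, Nat.cast_ite, Nat.cast_one, Nat.cast_zero]

theorem sum_exp_pairScore_le {k n : ℕ} (D : Fin n → RunDevice k) (s : BranchPair k)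
    {l l' : Fin k} (hl : l ≠ l') {t : ℝ} (ht : 0 ≤ t) (ht1 : t ≤ 1) (θ : ℝ) :
    ∑ y : Fin n → Bool → Bool, ∑ x : Fin n → Fin k → Bool, ∑ a : Fin n → Fin k → Bool,
      (∏ i, (D i).jointProb s (y i) (x i) (a i))
        * Real.exp (t * (∑ i, pairScore l l' (y i) (x i) (a i) - θ))
      ≤ Real.exp (0.81 * (t + t ^ 2) * n - t * θ) := by
  have e : ∀ (y : Fin n → Bool → Bool) (x a : Fin n → Fin k → Bool),
      (∏ i, (D i).jointProb s (y i) (x i) (a i))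
        * Real.exp (t * (∑ i, pairScore l l' (y i) (x i) (a i) - θ))
      = Real.exp (-(t * θ)) * ∏ i, ((D i).jointProb s (y i) (x i) (a i)
        * Real.exp (t * pairScore l l' (y i) (x i) (a i))) := by
    intro y x a
    rw [Finset.prod_mul_distrib, ← Real.exp_sum, ← Finset.mul_sum, mul_sub, sub_eq_add_neg,
      Real.exp_add]
    ring
  simp_rw [e, ← Finset.mul_sum]
  rw [sum_pi_prod fun i y x a => (D i).jointProb s y x a * Real.exp (t * pairScore l l' y x a)]
  have hp : ∏ i, ∑ y, ∑ x, ∑ a, (D i).jointProb s y x a * Real.exp (t * pairScore l l' y x a)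
      ≤ ∏ _i : Fin n, Real.exp (0.81 * (t + t ^ 2)) :=
    Finset.prod_le_prod (fun i _ => Finset.sum_nonneg fun y _ => Finset.sum_nonneg fun x _ =>
      Finset.sum_nonneg fun a _ => mul_nonneg ((D i).jointProb_nonneg _ _ _ _) (Real.exp_pos _).le)
      fun i _ => (D i).mgf_pairScore_le s hl ht ht1
  refine (mul_le_mul_of_nonneg_left hp (Real.exp_pos _).le).trans (le_of_eq ?_)
  rw [Finset.prod_const, ← Real.exp_nat_mul, ← Real.exp_add]
  simp
  ring

theorem card_branchPair_le (k : ℕ) : (Fintype.card (BranchPair k) : ℝ) ≤ (k : ℝ) ^ 2 := by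
  rw [Fintype.card_finset_len, Fintype.card_fin]
  exact_mod_cast Nat.choose_le_pow k 2

theorem le_double_sum {α β : Type*} [Fintype α] {f : α → β → ℝ} (hf : ∀ a b, 0 ≤ f a b)
    {P : Finset β} (a : α) {b : β} (hb : b ∈ P) : f a b ≤ ∑ a, ∑ b ∈ P, f a b :=
  (Finset.single_le_sum (fun b _ => hf a b) hb).trans
    (Finset.single_le_sum (f := fun a => ∑ b ∈ P, f a b)
      (fun a _ => Finset.sum_nonneg fun b _ => hf a b) (Finset.mem_univ a))

/-- Union bound over the targeted pair and over the pair of accepting branches. -/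
theorem QubitwiseAttack.forgeryProb_le_exp {k n : ℕ} (A : QubitwiseAttack k n) {t : ℝ}
    (ht : 0 ≤ t) (ht1 : t ≤ 1) (θ : ℝ) :
    A.forgeryProb θ ≤ (k : ℝ) ^ 4 * Real.exp (0.81 * (t + t ^ 2) * n - t * θ) := by
  classical
  set P : Finset (Fin k × Fin k) := Finset.univ.filter fun p => p.1 ≠ p.2 with hP
  have hpt : ∀ (y : Fin n → Bool → Bool) (x a : Fin n → Fin k → Bool),
      (if Forged θ y x a then A.jointProb y x a else 0)
        ≤ ∑ s : BranchPair k, ∑ p ∈ P, (∏ i, (A.device i).jointProb s (y i) (x i) (a i))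
          * Real.exp (t * (∑ i, pairScore p.1 p.2 (y i) (x i) (a i) - θ)) := by
    intro y x a
    have hnn : ∀ (s : BranchPair k) (p : Fin k × Fin k),
        0 ≤ (∏ i, (A.device i).jointProb s (y i) (x i) (a i))
          * Real.exp (t * (∑ i, pairScore p.1 p.2 (y i) (x i) (a i) - θ)) := fun s p =>
      mul_nonneg (Finset.prod_nonneg fun i _ => (A.device i).jointProb_nonneg _ _ _ _)
        (Real.exp_pos _).le
    split_ifs with hF
    · obtain ⟨l, l', hl, h1, h2⟩ := hF
      have hone : 1 ≤ Real.exp (t * (∑ i, pairScore l l' (y i) (x i) (a i) - θ)) := by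
        rw [Real.one_le_exp_iff, sum_pairScore]
        unfold Accepts at h1 h2
        exact mul_nonneg ht (by linarith)
      have hle := le_mul_of_one_le_right (A.jointProb_nonneg y x a) hone
      -- The true law is the term `s = A.target x`; adding the nonnegative terms of all other `s`
      -- removes the dependence on `x` and leaves product laws.
      have hsum := le_double_sum (f := fun (s : BranchPair k) (p : Fin k × Fin k) =>
        (∏ i, (A.device i).jointProb s (y i) (x i) (a i))
          * Real.exp (t * (∑ i, pairScore p.1 p.2 (y i) (x i) (a i) - θ)))
        hnn (P := P) (A.target x) (b := (l, l')) (by simp [hP, hl])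
      rw [A.jointProb_eq] at hle ⊢
      exact hle.trans hsum
    · exact Finset.sum_nonneg fun s _ => Finset.sum_nonneg fun p _ => hnn s p
  set B := Real.exp (0.81 * (t + t ^ 2) * n - t * θ)
  calc A.forgeryProb θ
      ≤ ∑ y : Fin n → Bool → Bool, ∑ x : Fin n → Fin k → Bool, ∑ a : Fin n → Fin k → Bool,
        ∑ s : BranchPair k, ∑ p ∈ P, (∏ i, (A.device i).jointProb s (y i) (x i) (a i))
          * Real.exp (t * (∑ i, pairScore p.1 p.2 (y i) (x i) (a i) - θ)) := by
        refine Finset.sum_le_sum fun y _ => Finset.sum_le_sum fun x _ =>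
          Finset.sum_le_sum fun a _ => ?_
        convert hpt y x a
    _ = ∑ s : BranchPair k, ∑ p ∈ P, ∑ y : Fin n → Bool → Bool, ∑ x : Fin n → Fin k → Bool,
        ∑ a : Fin n → Fin k → Bool, (∏ i, (A.device i).jointProb s (y i) (x i) (a i))
          * Real.exp (t * (∑ i, pairScore p.1 p.2 (y i) (x i) (a i) - θ)) := by
        simp only [← Finset.sum_comm (s := (Finset.univ : Finset (BranchPair k)))]
        simp only [← Finset.sum_comm (s := P)]
    _ ≤ ∑ _s : BranchPair k, ∑ _p ∈ P, B :=
        Finset.sum_le_sum fun s _ => Finset.sum_le_sum fun p hp =>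
          sum_exp_pairScore_le A.device s (by simpa [hP] using hp) ht ht1 θ
    _ = Fintype.card (BranchPair k) * (P.card * B) := by
        simp only [Finset.sum_const, nsmul_eq_mul, Finset.card_univ]
    _ ≤ (k : ℝ) ^ 2 * ((k : ℝ) ^ 2 * B) := by
        have hc : (P.card : ℝ) ≤ (k : ℝ) ^ 2 := by
          have h := Finset.card_le_univ P
          rw [Fintype.card_prod, Fintype.card_fin] at h
          rw [sq]; exact_mod_cast h
        have hB : 0 ≤ B := (Real.exp_pos _).le
        exact mul_le_mul (card_branchPair_le k) (mul_le_mul_of_nonneg_right hc hB)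
          (by positivity) (by positivity)
    _ = (k : ℝ) ^ 4 * B := by ring

theorem QubitwiseAttack.forgeryProb_eq_zero {k n : ℕ} (A : QubitwiseAttack k n) {θ : ℝ}
    (hθ : (n : ℝ) < θ) : A.forgeryProb θ = 0 := by
  refine Finset.sum_eq_zero fun y _ => Finset.sum_eq_zero fun x _ =>
    Finset.sum_eq_zero fun a _ => if_neg ?_
  rintro ⟨l, -, -, h, -⟩
  have hc : correctAnswers y x a l ≤ n :=
    (Finset.card_le_univ _).trans_eq (Fintype.card_fin n)
  have hc' : (correctAnswers y x a l : ℝ) ≤ n := by exact_mod_cast hc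
  unfold Accepts at h
  linarith

/-! ### Choice of parameters and conclusion -/

theorem le_criticalFraction {η : ℝ} (hη : 0 ≤ η) : 0.846 + 2.69 * η ≤ criticalFraction η := by
  have h2 : (1.41 : ℝ) ≤ Real.sqrt 2 := Real.le_sqrt_of_sq_le (by norm_num)
  have h3 : (1.73 : ℝ) ≤ Real.sqrt 3 := Real.le_sqrt_of_sq_le (by norm_num)
  unfold criticalFraction
  nlinarith

theorem theorem1 (k n : ℕ) (A : QubitwiseAttack k n) (η θ : ℝ) (hη : 0 ≤ η)
    (hθ : criticalFraction η * (n : ℝ) < θ) :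
    A.forgeryProb θ ≤ 10 * (k : ℝ) ^ 2 * Real.exp (-2 * η ^ 2 * (1 / 2 - η) * (n : ℝ)) := by
  have hn : (0 : ℝ) ≤ n := n.cast_nonneg
  have hcrit := mul_le_mul_of_nonneg_right (le_criticalFraction hη) hn
  rcases le_or_gt η 0.1 with h | h
  swap
  -- For `η > 0.1` the critical fraction exceeds `1`, so acceptance needs more than `n` correct
  -- answers.
  · rw [A.forgeryProb_eq_zero (by nlinarith)]
    positivity
  -- With `t = 1.5 * η` the exponent is at most `(-0.054 * η - 2.2125 * η ^ 2) * n`, below `-2 * η ^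
  -- 2 * n`.
  have hbound := A.forgeryProb_le_exp (t := 1.5 * η) (by positivity) (by linarith) θ
  set E := Real.exp (-η ^ 2 * n) with hE
  have hE0 : 0 < E := Real.exp_pos _
  have hexp : Real.exp (0.81 * (1.5 * η + (1.5 * η) ^ 2) * n - 1.5 * η * θ) ≤ E ^ 2 := by
    rw [hE, ← Real.exp_nat_mul, Real.exp_le_exp]
    have h1 : 1.5 * η * ((0.846 + 2.69 * η) * n) ≤ 1.5 * η * θ :=
      mul_le_mul_of_nonneg_left (hcrit.trans hθ.le) (by positivity)
    have h2 : 0 ≤ η * n := by positivity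
    have h3 : 0 ≤ η ^ 2 * n := by positivity
    push_cast
    nlinarith
  have hsq : A.forgeryProb θ ≤ ((k : ℝ) ^ 2 * E) ^ 2 :=
    hbound.trans (by
      have := mul_le_mul_of_nonneg_left hexp (show (0 : ℝ) ≤ (k : ℝ) ^ 4 by positivity)
      linarith)
  have hkE : 0 ≤ (k : ℝ) ^ 2 * E := by positivity
  -- `min 1 (u ^ 2) ≤ u` for `u ≥ 0` turns `k ^ 4` into `k ^ 2` at the price of half the exponent.
  have hmain : A.forgeryProb θ ≤ (k : ℝ) ^ 2 * E := by
    rcases le_total 1 ((k : ℝ) ^ 2 * E) with h1 | h1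
    · exact (A.forgeryProb_le_one θ).trans h1
    · exact hsq.trans (by nlinarith)
  have hlast : E ≤ Real.exp (-2 * η ^ 2 * (1 / 2 - η) * n) := by
    rw [hE, Real.exp_le_exp]
    have : 0 ≤ η ^ 3 * n := by positivity
    nlinarith
  have := mul_le_mul_of_nonneg_left hlast (show (0 : ℝ) ≤ (k : ℝ) ^ 2 by positivity)
  have : 0 ≤ (k : ℝ) ^ 2 * Real.exp (-2 * η ^ 2 * (1 / 2 - η) * n) := by positivity
  linarith
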